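/- Let $\mathcal C_*$ be a category enriched in simplicial sets, and let $\mathcal W_*\subset\mathcal C_*$ be a simplicial subcategory with the same objects: simplicial subsets $\mathcal W_*(a,b)\subset\mathcal C_*(a,b)$ containing the identities and closed under composition. For $k\ge 0$ let $\mathcal W_k\subset\mathcal C_k$ be the ordinary categories with the same objects and with the $k$-simplices of the mapping spaces as morphisms. For a category $\mathcal C$ and a subcategory $\mathcal W$ with the same objects, a reduced hammock of height $n$ from $a$ to $b$ is a commutative diagram in $\mathcal C$ with $n+1$ rows, each row a zigzag of $m\ge 0$ arrows from $a$ to $b$ (with $m$ the same for all rows and arbitrary), with vertical arrows from each row to the next between the intermediate objects, such that: vertical arrows and left-pointing horizontal arrows are in $\mathcal W$; all horizontal arrows in a column point in the same direction; arrows in adjacent columns point in different directions; and no column of horizontal arrows consists only of identities. A diagram violating the last two conditions is reduced by composing adjacent columns with the same direction and omitting columns of identities. Reduced hammocks of height $n$ are the $n$-simplices of a simplicial set $L^H_{\mathcal W}\mathcal C(a,b)$, whose faces and degeneracies delete or repeat a row and then reduce; composition is concatenation followed by reduction, and a morphism $f\colon a\to b$ of $\mathcal C$ is sent to the hammock with the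 single right-pointing arrow $f$ (reduced if $f$ is an identity). Let $L^H_{\mathcal W_*}\mathcal C_*(a,b)$ be the bisimplicial set whose $(k,\ell)$-simplices are the reduced hammocks of height $\ell$ from $a$ to $b$ in $(\mathcal C_k,\mathcal W_k)$. A map of bisimplicial sets is called a weak homotopy equivalence if the induced map of diagonal simplicial sets is a weak homotopy equivalence. **Proposition.** Let $\phi\colon b\to c$ be a morphism in $\mathcal W_*$ (a $0$-simplex of $\mathcal W_*(b,c)$). Then for every object $a$ of $\mathcal C_*$, composition with the degeneracies of $\phi$ gives weak homotopy equivalences \[ \phi_*\colon L^H_{\mathcal W_*}\mathcal C_*(a,b)\to L^H_{\mathcal W_*}\mathcal C_*(a,c) \quad\text{and}\quad \phi^*\colon L^H_{\mathcal W_*}\mathcal C_*(c,a)\to L^H_{\mathcal W_*}\mathcal C_*(b,a). \] -/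

import Mathlib

open CategoryTheory Opposite MonoidalCategory

universe u v u' v' u'' v''

namespace HammockLocalization

/-! ### Zigzags in a category and their reduction -/

/-- The direction of the horizontal arrows in a column. -/
inductive Dir : Type
  | right
  | left
  deriving DecidableEq

section Zigzag

variable {D : Type u} [Category.{v} D] {V : MorphismProperty D}

/-- A step from `x` to `y`: an arbitrary arrow `x ⟶ y` pointing to the right, or an arrow
`y ⟶ x` of `V` pointing to the left. -/
def Step (V : MorphismProperty D) : Dir → D → D → Type v
  | .right, x, y => (x ⟶ y)
  | .left, x, y => {f : y ⟶ x // V f}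

namespace Step

/-- An arrow pointing to the right, seen as a step. -/
def ofHom {x y : D} (f : x ⟶ y) : Step V .right x y := f

/-- The identity arrow, seen as a step in either direction. -/
def id (V : MorphismProperty D) [V.IsMultiplicative] : (d : Dir) → (x : D) → Step V d x x
  | .right, x => 𝟙 x
  | .left, x => ⟨𝟙 x, V.id_mem x⟩

/-- The composite of two consecutive steps in the same direction. -/
def comp [V.IsMultiplicative] :
    {d : Dir} → {x y z : D} → Step V d x y → Step V d y z → Step V d x z
  | .right, _, _, _, f, g => CategoryStruct.comp (obj := D) f g
  | .left, _, _, _, f, g => ⟨g.1 ≫ f.1, V.comp_mem _ _ g.2 f.2⟩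

/-- The step is an identity arrow. -/
inductive IsIdentity [V.IsMultiplicative] {d : Dir} : {x y : D} → Step V d x y → Prop
  | id (x : D) : IsIdentity (Step.id V d x)

lemma IsIdentity.eq [V.IsMultiplicative] {d : Dir} {x y : D} {s : Step V d x y}
    (h : s.IsIdentity) : x = y := by
  cases h; rfl

lemma id_comp [V.IsMultiplicative] {d : Dir} {x y : D} (s : Step V d x y) :
    (Step.id V d x).comp s = s := by
  cases d
  · exact Category.id_comp (obj := D) s
  · exact Subtype.ext (Category.comp_id _)

lemma comp_id [V.IsMultiplicative] {d : Dir} {x y : D} (s : Step V d x y) :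
    s.comp (Step.id V d y) = s := by
  cases d
  · exact Category.comp_id (obj := D) s
  · exact Subtype.ext (Category.id_comp _)

lemma assoc [V.IsMultiplicative] {d : Dir} {x y z t : D} (r : Step V d x y) (s : Step V d y z)
    (w : Step V d z t) : (r.comp s).comp w = r.comp (s.comp w) := by
  cases d
  · exact Category.assoc (obj := D) r s w
  · exact Subtype.ext (Category.assoc _ _ _).symm

/-- The image of a step under a functor. -/
def map {D' : Type u'} [Category.{v'} D'] {V' : MorphismProperty D'} (F : D ⥤ D')
    (hF : V ≤ V'.inverseImage F) :
    {d : Dir} → {x y : D} → Step V d x y → Step V' d (F.obj x) (F.obj y)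
  | .right, _, _, f => CategoryTheory.Functor.map F f
  | .left, _, _, f => ⟨F.map f.1, hF _ f.2⟩

end Step

/-- Zigzags (not necessarily reduced) of arbitrary finite length from an object to another
one, whose left-pointing arrows are in `V`. -/
inductive Zigzag (V : MorphismProperty D) : D → D → Type (max u v)
  | nil (x : D) : Zigzag V x x
  | cons {d : Dir} {x y z : D} (s : Step V d x y) (w : Zigzag V y z) : Zigzag V x z

namespace Zigzag

/-- The direction of the first arrow, if there is one. -/
def firstDir : {x y : D} → Zigzag V x y → Option Dir
  | _, _, nil _ => none
  | _, _, cons (d := d) _ _ => some d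

/-- Concatenation. -/
def append : {x y z : D} → Zigzag V x y → Zigzag V y z → Zigzag V x z
  | _, _, _, nil _, w' => w'
  | _, _, _, cons s w, w' => cons s (append w w')

section Functoriality

variable {D' : Type u'} [Category.{v'} D'] {V' : MorphismProperty D'}
  {D'' : Type u''} [Category.{v''} D''] {V'' : MorphismProperty D''}

/-- The image of a zigzag under a functor. -/
def map (F : D ⥤ D') (hF : V ≤ V'.inverseImage F) :
    {x y : D} → Zigzag V x y → Zigzag V' (F.obj x) (F.obj y)
  | _, _, nil x => nil (F.obj x)
  | _, _, cons s w => cons (s.map F hF) (map F hF w)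

/-- The image of a zigzag under a functor, with prescribed names for the images of the
endpoints. -/
def mapTo (F : D ⥤ D') (hF : V ≤ V'.inverseImage F) {x y : D} {x' y' : D'}
    (hx : F.obj x = x') (hy : F.obj y = y') (w : Zigzag V x y) : Zigzag V' x' y' :=
  cast (by rw [hx, hy]) (map F hF w)

lemma map_append (F : D ⥤ D') (hF : V ≤ V'.inverseImage F) {x y z : D} (w : Zigzag V x y)
    (w' : Zigzag V y z) : map F hF (append w w') = append (map F hF w) (map F hF w') := by
  induction w with
  | nil => rfl
  | cons s w ih => simp only [append, map, ih]

lemma map_id {x y : D} (w : Zigzag V x y) : map (𝟭 D) (fun _ _ _ h ↦ h) w = w := by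
  induction w with
  | nil => rfl
  | @cons d x y z s w ih =>
    simp only [map]
    rw [ih]
    cases d <;> rfl

lemma map_map (F : D ⥤ D') (hF : V ≤ V'.inverseImage F) (G : D' ⥤ D'')
    (hG : V' ≤ V''.inverseImage G) {x y : D} (w : Zigzag V x y) :
    map G hG (map F hF w) = map (F ⋙ G) (fun _ _ _ h ↦ hG _ (hF _ h)) w := by
  induction w with
  | nil => rfl
  | @cons d x y z s w ih =>
    simp only [map]
    rw [ih]
    cases d <;> rfl

lemma mapTo_append (F : D ⥤ D') (hF : V ≤ V'.inverseImage F) {x y z : D} {x' y' z' : D'}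
    (hx : F.obj x = x') (hy : F.obj y = y') (hz : F.obj z = z') (w : Zigzag V x y)
    (w' : Zigzag V y z) :
    mapTo F hF hx hz (append w w') = append (mapTo F hF hx hy w) (mapTo F hF hy hz w') := by
  subst hx hy hz
  exact map_append F hF w w'

lemma mapTo_mapTo (F : D ⥤ D') (hF : V ≤ V'.inverseImage F) (G : D' ⥤ D'')
    (hG : V' ≤ V''.inverseImage G) {x y : D} {x' y' : D'} {x'' y'' : D''}
    (hx : F.obj x = x') (hy : F.obj y = y') (hx' : G.obj x' = x'') (hy' : G.obj y' = y'')
    (hx'' : G.obj (F.obj x) = x'') (hy'' : G.obj (F.obj y) = y'') (w : Zigzag V x y) :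
    mapTo G hG hx' hy' (mapTo F hF hx hy w) =
      mapTo (F ⋙ G) (fun _ _ _ h ↦ hG _ (hF _ h)) hx'' hy'' w := by
  subst hx hy hx' hy'
  exact map_map F hF G hG w

lemma mapTo_cons_nil (F : D ⥤ D') (hF : V ≤ V'.inverseImage F) {x y : D} {x' y' : D'}
    (hx : F.obj x = x') (hy : F.obj y = y') (f : x ⟶ y) :
    mapTo F hF hx hy (cons (Step.ofHom f) (nil y)) =
      cons (Step.ofHom (eqToHom hx.symm ≫ F.map f ≫ eqToHom hy)) (nil y') := by
  subst hx hy
  rw [eqToHom_refl, eqToHom_refl, Category.comp_id, Category.id_comp]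
  rfl

end Functoriality

variable [V.IsMultiplicative]

/-- No arrow is an identity and adjacent arrows point in different directions. -/
def Reduced : {x y : D} → Zigzag V x y → Prop
  | _, _, nil _ => True
  | _, _, cons (d := d) s w => ¬ s.IsIdentity ∧ w.firstDir ≠ some d ∧ Reduced w

open Classical in
/-- Put a step in front of a zigzag, omitting it if it is an identity. -/
noncomputable def consOrOmit {d : Dir} {x y z : D} (s : Step V d x y) (w : Zigzag V y z) :
    Zigzag V x z :=
  if h : s.IsIdentity then cast (by rw [h.eq]) w else cons s w

/-- Put a step in front of a zigzag, composing it with the first step of the zigzag if both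
have the same direction, and omitting the resulting step if it is an identity. -/
noncomputable def push {d : Dir} {x y z : D} (s : Step V d x y) :
    Zigzag V y z → Zigzag V x z
  | nil _ => consOrOmit s (nil _)
  | cons (d := d') t w =>
      if h : d' = d then consOrOmit (s.comp (h ▸ t)) w else consOrOmit s (cons t w)

/-- The reduction of a zigzag: adjacent steps in the same direction are composed and identities
are omitted until the zigzag is reduced. -/
noncomputable def reduce : {x y : D} → Zigzag V x y → Zigzag V x y
  | _, _, nil x => nil x
  | _, _, cons s w => push s (reduce w)

lemma consOrOmit_id {d : Dir} {x z : D} (w : Zigzag V x z) :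
    consOrOmit (Step.id V d x) w = w := by
  simp [consOrOmit, Step.IsIdentity.id]

lemma consOrOmit_of_not {d : Dir} {x y z : D} {s : Step V d x y} (h : ¬ s.IsIdentity)
    (w : Zigzag V y z) : consOrOmit s w = cons s w := by
  simp [consOrOmit, h]

lemma push_of_firstDir_ne {d : Dir} {x y z : D} (s : Step V d x y) (w : Zigzag V y z)
    (h : w.firstDir ≠ some d) : push s w = consOrOmit s w := by
  cases w with
  | nil => rfl
  | cons t w =>
    have h' : ¬ _ = d := fun e ↦ h (congrArg some e)
    simp [push, h']

lemma push_cons_same {d : Dir} {x y z t : D} (r : Step V d x y) (s : Step V d y z)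
    (w : Zigzag V z t) : push r (cons s w) = consOrOmit (r.comp s) w := by
  simp [push]

lemma reduced_consOrOmit {d : Dir} {x y z : D} (s : Step V d x y) (w : Zigzag V y z)
    (hw : w.Reduced) (h : w.firstDir ≠ some d) : (consOrOmit s w).Reduced := by
  by_cases hs : s.IsIdentity
  · cases hs
    rwa [consOrOmit_id]
  · rw [consOrOmit_of_not hs]
    exact ⟨hs, h, hw⟩

lemma reduced_push {d : Dir} {x y z : D} (s : Step V d x y) (w : Zigzag V y z)
    (hw : w.Reduced) : (push s w).Reduced := by
  by_cases h : w.firstDir = some d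
  · cases w with
    | nil => cases h
    | cons t w =>
      cases h
      rw [push_cons_same]
      exact reduced_consOrOmit _ _ hw.2.2 hw.2.1
  · rw [push_of_firstDir_ne _ _ h]
    exact reduced_consOrOmit _ _ hw h

lemma reduced_reduce {x y : D} (w : Zigzag V x y) : w.reduce.Reduced := by
  induction w with
  | nil => trivial
  | cons s w ih => exact reduced_push _ _ ih

lemma push_id {d : Dir} {x y : D} (w : Zigzag V x y) (hw : w.Reduced) :
    push (Step.id V d x) w = w := by
  by_cases h : w.firstDir = some d
  · cases w with
    | nil => cases h
    | cons t w =>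
      cases h
      rw [push_cons_same, Step.id_comp, consOrOmit_of_not hw.1]
  · rw [push_of_firstDir_ne _ _ h, consOrOmit_id]

lemma push_consOrOmit {d : Dir} {x y z t : D} (r : Step V d x y) (s : Step V d y z)
    (w : Zigzag V z t) (h : w.firstDir ≠ some d) :
    push r (consOrOmit s w) = consOrOmit (r.comp s) w := by
  by_cases hs : s.IsIdentity
  · cases hs
    rw [consOrOmit_id, Step.comp_id, push_of_firstDir_ne _ _ h]
  · rw [consOrOmit_of_not hs, push_cons_same]

lemma push_push {d : Dir} {x y z t : D} (r : Step V d x y) (s : Step V d y z)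
    (w : Zigzag V z t) (hw : w.Reduced) : push r (push s w) = push (r.comp s) w := by
  by_cases h : w.firstDir = some d
  · cases w with
    | nil => cases h
    | cons q w =>
      cases h
      rw [push_cons_same, push_cons_same, push_consOrOmit _ _ _ hw.2.1, Step.assoc]
  · rw [push_of_firstDir_ne _ _ h, push_of_firstDir_ne _ _ h, push_consOrOmit _ _ _ h]

lemma reduce_of_reduced {x y : D} (w : Zigzag V x y) (hw : w.Reduced) : w.reduce = w := by
  induction w with
  | nil => rfl
  | cons s w ih =>
    rw [reduce, ih hw.2.2, push_of_firstDir_ne _ _ hw.2.1, consOrOmit_of_not hw.1]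

/-- Operations on zigzags that are built letter by letter are compatible with reduction. -/
lemma apply_reduce_aux {D' : Type u'} [Category.{v'} D'] {V' : MorphismProperty D'}
    [V'.IsMultiplicative] (o : D → D') {y : D} {y' : D'}
    (st : ∀ {d : Dir} {p q : D}, Step V d p q → Step V' d (o p) (o q))
    (st_id : ∀ (d : Dir) (p : D), st (Step.id V d p) = Step.id V' d (o p))
    (st_comp : ∀ {d : Dir} {p q r : D} (s : Step V d p q) (t : Step V d q r),
      st (s.comp t) = (st s).comp (st t))
    (Φ : ∀ {x : D}, Zigzag V x y → Zigzag V' (o x) y')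
    (hΦ : ∀ {d : Dir} {p q : D} (s : Step V d p q) (w : Zigzag V q y),
      Φ (cons s w) = cons (st s) (Φ w))
    {x : D} (w : Zigzag V x y) : (Φ w.reduce).reduce = (Φ w).reduce := by
  have key : ∀ {d : Dir} {p q : D} (s : Step V d p q) (w : Zigzag V q y),
      (Φ (consOrOmit s w)).reduce = push (st s) (Φ w).reduce := by
    intro d p q s w
    by_cases hs : s.IsIdentity
    · cases hs
      rw [consOrOmit_id, st_id, push_id _ (reduced_reduce _)]
    · rw [consOrOmit_of_not hs, hΦ, reduce]
  have key' : ∀ {d : Dir} {p q : D} (s : Step V d p q) (w : Zigzag V q y),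
      (Φ (push s w)).reduce = push (st s) (Φ w).reduce := by
    intro d p q s w
    by_cases h : w.firstDir = some d
    · cases w with
      | nil => cases h
      | cons t w =>
        cases h
        rw [push_cons_same, key, st_comp, hΦ, reduce, push_push _ _ _ (reduced_reduce _)]
    · rw [push_of_firstDir_ne _ _ h, key]
  induction w with
  | nil => rfl
  | cons s w ih => rw [reduce, key', ih Φ hΦ key key', hΦ, reduce]

lemma reduce_append_reduce_left {x y z : D} (w : Zigzag V x y) (w' : Zigzag V y z) :
    (append w.reduce w').reduce = (append w w').reduce :=
  apply_reduce_aux (fun x ↦ x) (fun s ↦ s) (fun _ _ ↦ rfl) (fun _ _ ↦ rfl)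
    (fun w ↦ append w w') (fun _ _ ↦ rfl) w

lemma reduce_append_reduce_right {x y z : D} (w : Zigzag V x y) (w' : Zigzag V y z) :
    (append w w'.reduce).reduce = (append w w').reduce := by
  induction w with
  | nil => exact reduce_of_reduced _ (reduced_reduce _)
  | cons s w ih => rw [append, append, reduce, reduce, ih]

lemma reduce_mapTo_reduce {D' : Type u'} [Category.{v'} D'] {V' : MorphismProperty D'}
    [V'.IsMultiplicative] (F : D ⥤ D') (hF : V ≤ V'.inverseImage F) {x y : D} {x' y' : D'}
    (hx : F.obj x = x') (hy : F.obj y = y') (w : Zigzag V x y) :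
    (mapTo F hF hx hy w.reduce).reduce = (mapTo F hF hx hy w).reduce := by
  subst hx hy
  refine apply_reduce_aux F.obj (fun s ↦ s.map F hF) ?_ ?_ (fun w ↦ map F hF w)
    (fun _ _ ↦ rfl) w
  · intro d p
    cases d
    · exact F.map_id p
    · exact Subtype.ext (F.map_id p)
  · intro d p q r s t
    cases d
    · exact F.map_comp _ _
    · exact Subtype.ext (F.map_comp _ _)

end Zigzag

end Zigzag

/-! ### The hammock localization of a category -/

section Hammock

variable {C : Type u} [Category.{v} C]

/-- A column of objects of a hammock of height `n`: a chain `k₀ ⟶ k₁ ⟶ ⋯ ⟶ kₙ` of arrows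
of `W`. -/
structure Chain (W : MorphismProperty C) (n : SimplexCategory) where
  /-- the chain -/
  functor : Fin (n.len + 1) ⥤ C
  mem {i j : Fin (n.len + 1)} (h : i ⟶ j) : W (functor.map h)

namespace Chain

/-- A morphism of chains is a column of horizontal arrows making all the squares commute. -/
instance (W : MorphismProperty C) (n : SimplexCategory) : Category (Chain W n) where
  Hom X Y := X.functor ⟶ Y.functor
  id X := 𝟙 X.functor
  comp f g := NatTrans.vcomp f g

/-- The columns of horizontal arrows that are all in `W`. -/
def levelwise (W : MorphismProperty C) (n : SimplexCategory) :
    MorphismProperty (Chain W n) :=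
  fun _ _ f ↦ ∀ i, W (NatTrans.app f i)

instance (W : MorphismProperty C) [W.IsMultiplicative] (n : SimplexCategory) :
    (levelwise W n).IsMultiplicative where
  id_mem _ _ := W.id_mem _
  comp_mem _ _ hf hg i := W.comp_mem _ _ (hf i) (hg i)

/-- The column of identities of an object. -/
def const (W : MorphismProperty C) [W.IsMultiplicative] (n : SimplexCategory) (a : C) :
    Chain W n where
  functor := (Functor.const _).obj a
  mem _ := W.id_mem a

/-- The column all of whose horizontal arrows are `f`. -/
def constMap (W : MorphismProperty C) [W.IsMultiplicative] (n : SimplexCategory) {a b : C}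
    (f : a ⟶ b) : const W n a ⟶ const W n b :=
  (Functor.const (Fin (n.len + 1))).map f

variable {C' : Type u'} [Category.{v'} C'] {W : MorphismProperty C} {W' : MorphismProperty C'}

/-- Reindex the rows of chains along `θ` and apply the functor `G` to them. -/
def transform {m n : SimplexCategory} (θ : m ⟶ n) (G : C ⥤ C') (hG : W ≤ W'.inverseImage G) :
    Chain W n ⥤ Chain W' m where
  obj X :=
    { functor := θ.toOrderHom.monotone.functor ⋙ X.functor ⋙ G
      mem := fun _ ↦ hG _ (X.mem _) }
  map f := Functor.whiskerLeft θ.toOrderHom.monotone.functor (Functor.whiskerRight f G)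
  map_id X := by
    apply NatTrans.ext
    funext i
    exact G.map_id _
  map_comp f g := by
    apply NatTrans.ext
    funext i
    exact G.map_comp _ _

lemma transform_levelwise {m n : SimplexCategory} (θ : m ⟶ n) (G : C ⥤ C')
    (hG : W ≤ W'.inverseImage G) :
    levelwise W n ≤ (levelwise W' m).inverseImage (transform θ G hG) :=
  fun _ _ _ hf _ ↦ hG _ (hf _)

lemma transform_const [W.IsMultiplicative] [W'.IsMultiplicative] {m n : SimplexCategory}
    (θ : m ⟶ n) (G : C ⥤ C') (hG : W ≤ W'.inverseImage G) {a : C} {a' : C'}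
    (ha : G.obj a = a') : (transform θ G hG).obj (const W n a) = const W' m a' := by
  subst ha
  have : ((θ.toOrderHom.monotone.functor ⋙ (Functor.const _).obj a ⋙ G) : _ ⥤ C') =
      (Functor.const _).obj (G.obj a) :=
    CategoryTheory.Functor.ext (fun _ ↦ rfl) (fun _ _ _ ↦ (G.map_id a).trans (by simp))
  simp only [transform, const, this]

lemma eqToHom_app {n : SimplexCategory} {X Y : Chain W n} (h : X = Y) (i : Fin (n.len + 1)) :
    NatTrans.app (eqToHom h : X ⟶ Y) i = eqToHom (by rw [h]) := by
  subst h
  rfl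

end Chain

/-- The reduced hammocks of height `n` from `a` to `b`: reduced zigzags of columns, from the
column of identities of `a` to that of `b`. -/
def Hammock (W : MorphismProperty C) [W.IsMultiplicative] (n : SimplexCategory) (a b : C) :
    Type (max u v) :=
  {w : Zigzag (Chain.levelwise W n) (Chain.const W n a) (Chain.const W n b) // w.Reduced}

namespace Hammock

variable {W : MorphismProperty C} [W.IsMultiplicative] {n : SimplexCategory}

/-- The hammock obtained by reduction. -/
noncomputable def mk {a b : C}
    (w : Zigzag (Chain.levelwise W n) (Chain.const W n a) (Chain.const W n b)) :
    Hammock W n a b :=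
  ⟨w.reduce, w.reduced_reduce⟩

/-- The hammock given by a morphism `f : a ⟶ b`: its only column has the arrow `f`, pointing
to the right, in every row (this column is omitted if `f` is an identity). -/
noncomputable def ofHom (n : SimplexCategory) {a b : C} (f : a ⟶ b) : Hammock W n a b :=
  mk (.cons (Step.ofHom (Chain.constMap W n f)) (.nil _))

/-- Composition of hammocks: concatenate along a column of identities and reduce. -/
noncomputable def comp {a b c : C} (x : Hammock W n a b) (y : Hammock W n b c) :
    Hammock W n a c :=
  mk (x.1.append y.1)

variable {C' : Type u'} [Category.{v'} C'] {W' : MorphismProperty C'} [W'.IsMultiplicative]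
  {C'' : Type u''} [Category.{v''} C''] {W'' : MorphismProperty C''} [W''.IsMultiplicative]

/-- Reindex the rows of a hammock along `θ` (for a face map this deletes a row, for a degeneracy
it repeats a row), apply the functor `G`, and reduce. -/
noncomputable def transform {m : SimplexCategory} (θ : m ⟶ n) (G : C ⥤ C')
    (hG : W ≤ W'.inverseImage G) {a b : C} {a' b' : C'} (ha : G.obj a = a') (hb : G.obj b = b')
    (x : Hammock W n a b) : Hammock W' m a' b' :=
  mk (x.1.mapTo (Chain.transform θ G hG) (Chain.transform_levelwise θ G hG)
    (Chain.transform_const θ G hG ha) (Chain.transform_const θ G hG hb))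

lemma transform_id {a b : C} (x : Hammock W n a b) :
    transform (𝟙 n) (𝟭 C) (fun _ _ _ h ↦ h) rfl rfl x = x := by
  apply Subtype.ext
  exact (congrArg Zigzag.reduce (Zigzag.map_id x.1)).trans (Zigzag.reduce_of_reduced _ x.2)

lemma transform_transform {m l : SimplexCategory} (θ : m ⟶ n) (G : C ⥤ C')
    (hG : W ≤ W'.inverseImage G) {a b : C} {a' b' : C'} (ha : G.obj a = a') (hb : G.obj b = b')
    (θ' : l ⟶ m) (G' : C' ⥤ C'') (hG' : W' ≤ W''.inverseImage G') {a'' b'' : C''}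
    (ha' : G'.obj a' = a'') (hb' : G'.obj b' = b'') (H : C ⥤ C'') (hH : G ⋙ G' = H)
    (hW : W ≤ W''.inverseImage H) (ha'' : H.obj a = a'') (hb'' : H.obj b = b'')
    (x : Hammock W n a b) :
    transform θ' G' hG' ha' hb' (transform θ G hG ha hb x) =
      transform (θ' ≫ θ) H hW ha'' hb'' x := by
  subst hH
  apply Subtype.ext
  refine (Zigzag.reduce_mapTo_reduce _ _ _ _ _).trans (congrArg Zigzag.reduce ?_)
  exact Zigzag.mapTo_mapTo _ _ _ _ _ _ _ _
    (Chain.transform_const (θ' ≫ θ) (G ⋙ G') hW ha'')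
    (Chain.transform_const (θ' ≫ θ) (G ⋙ G') hW hb'') x.1

lemma transform_congr {m : SimplexCategory} (θ : m ⟶ n) {G H : C ⥤ C'} (h : G = H)
    (hG : W ≤ W'.inverseImage G) (hH : W ≤ W'.inverseImage H) {a b : C} {a' b' : C'}
    (ha : G.obj a = a') (hb : G.obj b = b') (ha' : H.obj a = a') (hb' : H.obj b = b')
    (x : Hammock W n a b) : transform θ G hG ha hb x = transform θ H hH ha' hb' x := by
  subst h
  rfl

lemma transform_comp {m : SimplexCategory} (θ : m ⟶ n) (G : C ⥤ C')
    (hG : W ≤ W'.inverseImage G) {a b c : C} {a' b' c' : C'} (ha : G.obj a = a')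
    (hb : G.obj b = b') (hc : G.obj c = c') (x : Hammock W n a b) (y : Hammock W n b c) :
    transform θ G hG ha hc (x.comp y) =
      (transform θ G hG ha hb x).comp (transform θ G hG hb hc y) := by
  apply Subtype.ext
  refine (Zigzag.reduce_mapTo_reduce _ _ _ _ _).trans ?_
  refine Eq.trans ?_ (Zigzag.reduce_append_reduce_left _ _).symm
  refine Eq.trans ?_ (Zigzag.reduce_append_reduce_right _ _).symm
  exact congrArg Zigzag.reduce (Zigzag.mapTo_append _ _ _ _ _ _ _)

lemma transform_ofHom {m : SimplexCategory} (θ : m ⟶ n) (G : C ⥤ C')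
    (hG : W ≤ W'.inverseImage G) {a b : C} {a' b' : C'} (ha : G.obj a = a') (hb : G.obj b = b')
    (f : a ⟶ b) :
    transform θ G hG ha hb (ofHom n f) =
      ofHom m (eqToHom ha.symm ≫ G.map f ≫ eqToHom hb) := by
  apply Subtype.ext
  refine (Zigzag.reduce_mapTo_reduce _ _ _ _ _).trans (congrArg Zigzag.reduce ?_)
  rw [Zigzag.mapTo_cons_nil]
  congr 2
  apply NatTrans.ext
  funext i
  have h₁ := Chain.eqToHom_app (Chain.transform_const θ G hG ha).symm i
  have h₂ := Chain.eqToHom_app (Chain.transform_const θ G hG hb) i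
  refine (congrArg₂ (fun p q ↦ CategoryStruct.comp (obj := C') p
    (CategoryStruct.comp (obj := C') (G.map f) q)) h₁ h₂).trans ?_
  rfl

end Hammock

/-- The simplicial set of morphisms from `a` to `b` in the hammock localization of `C` at
`W`. -/
noncomputable def hammockSpace (W : MorphismProperty C) [W.IsMultiplicative] (a b : C) :
    SSet.{max u v} where
  obj n := Hammock W n.unop a b
  map θ := ↾(Hammock.transform θ.unop (𝟭 C) (fun _ _ _ h ↦ h) rfl rfl)
  map_id n := by
    ext x
    exact Hammock.transform_id x
  map_comp θ θ' := by
    ext x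
    exact (Hammock.transform_transform θ.unop (𝟭 C) _ rfl rfl θ'.unop (𝟭 C) _ rfl rfl (𝟭 C) rfl
      (fun _ _ _ h ↦ h) rfl rfl x).symm

end Hammock

/-! ### Bisimplicial sets and weak homotopy equivalences -/

/-- The category of bisimplicial sets: `X.obj (op ⦋k⦌)` is the simplicial set `X_{k,*}`. -/
abbrev BisimplicialSet : Type (u + 1) := SimplexCategoryᵒᵖ ⥤ SSet.{u}

/-- The diagonal of a bisimplicial set. -/
def diag : BisimplicialSet.{u} ⥤ SSet.{u} where
  obj X :=
    { obj := fun n ↦ (X.obj n).obj n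
      map := fun {m n} θ ↦ (X.map θ).app m ≫ (X.obj n).map θ }
  map f :=
    { app := fun n ↦ (f.app n).app n }

/-- The set `[X, Z]` of homotopy classes of maps: the quotient of the set of maps `X ⟶ Z` by the
equivalence relation generated by simplicial homotopy (which, for a Kan complex `Z`, is the
relation of simplicial homotopy itself). -/
def HomotopyClass (X Z : SSet.{u}) : Type u :=
  Quot fun f g : X ⟶ Z ↦ Nonempty (SSet.Homotopy f g)

/-- The map `[Y, Z] → [X, Z]` of precomposition with `f : X ⟶ Y`. -/
def HomotopyClass.precomp {X Y : SSet.{u}} (f : X ⟶ Y) (Z : SSet.{u}) :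
    HomotopyClass Y Z → HomotopyClass X Z :=
  Quot.map (fun g ↦ f ≫ g) fun g g' ⟨H⟩ ↦ ⟨SSet.RelativeMorphism.Homotopy.precomp H
    (A := ⊥) (φ := SSet.Subcomplex.isInitialBot.to _) { map := f }
    (SSet.Subcomplex.isInitialBot.hom_ext _ _)⟩

/-- A map of simplicial sets `f : X ⟶ Y` is a weak homotopy equivalence if for every Kan
complex `Z` precomposition with `f` is a bijection `[Y, Z] → [X, Z]`. -/
def IsWeakHomotopyEquivalence {X Y : SSet.{u}} (f : X ⟶ Y) : Prop :=
  ∀ (Z : SSet.{u}) [SSet.KanComplex Z], Function.Bijective (HomotopyClass.precomp f Z)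

/-! ### Simplicially enriched categories and their hammock localization -/

section Enriched

variable (C : Type u) [EnrichedCategory SSet.{v} C]

/-- The category `C_k` with the same objects as `C`, whose morphisms are the `k`-simplices of
the simplicial sets of morphisms of `C`. -/
def Level (_ : SimplexCategoryᵒᵖ) : Type u := C

variable {C}

instance (k : SimplexCategoryᵒᵖ) : Category.{v} (Level C k) where
  Hom a b := (EnrichedCategory.Hom (V := SSet.{v}) (C := C) a b).obj k
  id a := (eId SSet.{v} (C := C) a).app k PUnit.unit
  comp {a b c} f g := (eComp SSet.{v} (C := C) a b c).app k ⟨f, g⟩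
  id_comp {a b} f := ConcreteCategory.congr_hom
    (NatTrans.congr_app (e_id_comp SSet.{v} (C := C) a b) k) f
  comp_id {a b} f := ConcreteCategory.congr_hom
    (NatTrans.congr_app (e_comp_id SSet.{v} (C := C) a b) k) f
  assoc {a b c d} f g h := ConcreteCategory.congr_hom
    (NatTrans.congr_app (e_assoc SSet.{v} (C := C) a b c d) k) ⟨f, ⟨g, h⟩⟩

/-- The functor `C_k ⥤ C_l` given by the simplicial structure maps of the simplicial sets of
morphisms. -/
def levelFunctor {k l : SimplexCategoryᵒᵖ} (α : k ⟶ l) : Level C k ⥤ Level C l where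
  obj a := a
  map {a b} f := (EnrichedCategory.Hom (V := SSet.{v}) (C := C) a b).map α f
  map_id a := (ConcreteCategory.congr_hom ((eId SSet.{v} (C := C) a).naturality α)
    PUnit.unit).symm
  map_comp {a b c} f g := (ConcreteCategory.congr_hom
    ((eComp SSet.{v} (C := C) a b c).naturality α) ⟨f, g⟩).symm

lemma levelFunctor_id (k : SimplexCategoryᵒᵖ) :
    𝟭 (Level C k) = levelFunctor (𝟙 k) :=
  CategoryTheory.Functor.hext (fun _ ↦ rfl) fun a b f ↦ heq_of_eq
    (ConcreteCategory.congr_hom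
      ((EnrichedCategory.Hom (V := SSet.{v}) (C := C) a b).map_id k) f).symm

lemma levelFunctor_comp {k l m : SimplexCategoryᵒᵖ} (α : k ⟶ l) (β : l ⟶ m) :
    levelFunctor α ⋙ levelFunctor β = levelFunctor (C := C) (α ≫ β) :=
  CategoryTheory.Functor.hext (fun _ ↦ rfl) fun a b f ↦ heq_of_eq
    (ConcreteCategory.congr_hom
      ((EnrichedCategory.Hom (V := SSet.{v}) (C := C) a b).map_comp α β) f).symm

variable (C)

/-- A simplicial subcategory of `C` with the same objects. -/
structure SimplicialSubcategory where
  /-- the simplicial subset of morphisms -/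
  hom (a b : C) : (EnrichedCategory.Hom (V := SSet.{v}) a b).Subcomplex
  id_mem (k : SimplexCategoryᵒᵖ) (a : Level C k) : 𝟙 a ∈ (hom a a).obj k
  comp_mem {k : SimplexCategoryᵒᵖ} {a b c : Level C k} (f : a ⟶ b) (g : b ⟶ c)
    (hf : f ∈ (hom a b).obj k) (hg : g ∈ (hom b c).obj k) : f ≫ g ∈ (hom a c).obj k

variable {C}

namespace SimplicialSubcategory

/-- The subcategory `W_k` of `C_k`. -/
def level (W : SimplicialSubcategory.{u, v} C) (k : SimplexCategoryᵒᵖ) :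
    MorphismProperty (Level C k) :=
  fun a b f ↦ f ∈ (W.hom a b).obj k

instance (W : SimplicialSubcategory.{u, v} C) (k : SimplexCategoryᵒᵖ) :
    (W.level k).IsMultiplicative where
  id_mem a := W.id_mem k a
  comp_mem f g hf hg := W.comp_mem f g hf hg

lemma level_le (W : SimplicialSubcategory.{u, v} C) {k l : SimplexCategoryᵒᵖ} (α : k ⟶ l) :
    W.level k ≤ (W.level l).inverseImage (levelFunctor α) :=
  fun a b _ hf ↦ (W.hom a b).map α hf

/-- The bisimplicial set of morphisms from `a` to `b` in the hammock localization of the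
simplicially enriched category `C` at `W`: in bidegree `(k, l)` it consists of the reduced
hammocks of height `l` in `C_k`. -/
noncomputable def localizedHom (W : SimplicialSubcategory.{u, v} C) (a b : C) :
    BisimplicialSet.{max u v} where
  obj k := hammockSpace (W.level k) a b
  map {k k'} α :=
    { app := fun l ↦ ↾(Hammock.transform (𝟙 l.unop) (levelFunctor α) (W.level_le α) rfl rfl)
      naturality := fun l l' θ ↦ by
        ext x
        exact (Hammock.transform_transform θ.unop (𝟭 _) _ rfl rfl (𝟙 _) (levelFunctor α) _
          rfl rfl (levelFunctor α) rfl (W.level_le α) rfl rfl x).trans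
          (Hammock.transform_transform (𝟙 _) (levelFunctor α) _ rfl rfl θ.unop (𝟭 _) _
            rfl rfl (levelFunctor α) rfl (W.level_le α) rfl rfl x).symm }
  map_id k := by
    ext l x
    refine Eq.trans ?_ (Hammock.transform_id x)
    exact Hammock.transform_congr (𝟙 l.unop) (levelFunctor_id k).symm _ _ rfl rfl rfl rfl x
  map_comp α β := by
    ext l x
    exact (Hammock.transform_transform (𝟙 _) (levelFunctor α) (W.level_le α) rfl rfl (𝟙 _)
      (levelFunctor β) (W.level_le β) rfl rfl (levelFunctor (α ≫ β)) (levelFunctor_comp α β)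
      (W.level_le _) rfl rfl x).symm

/-- The `k`-simplex `φ_k`, a morphism of `C_k`, that is the iterated degeneracy of a morphism
(a `0`-simplex) `φ` of `C`. -/
def degenerate {b c : C}
    (φ : (EnrichedCategory.Hom (V := SSet.{v}) b c).obj (op (SimplexCategory.mk 0)))
    (k : SimplexCategoryᵒᵖ) : Quiver.Hom (V := Level C k) b c :=
  (EnrichedCategory.Hom (V := SSet.{v}) b c).map
    (SimplexCategory.const k.unop (SimplexCategory.mk 0) 0).op φ

lemma degenerate_map {b c : C}
    (φ : (EnrichedCategory.Hom (V := SSet.{v}) b c).obj (op (SimplexCategory.mk 0)))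
    {k k' : SimplexCategoryᵒᵖ} (α : k ⟶ k') :
    (levelFunctor α).map (degenerate φ k) = degenerate φ k' :=
  (ConcreteCategory.congr_hom ((EnrichedCategory.Hom (V := SSet.{v}) b c).map_comp
    (SimplexCategory.const k.unop (SimplexCategory.mk 0) 0).op α) φ).symm

lemma transform_ofHom_degenerate (W : SimplicialSubcategory.{u, v} C) {b c : C}
    (φ : (EnrichedCategory.Hom (V := SSet.{v}) b c).obj (op (SimplexCategory.mk 0)))
    {k k' : SimplexCategoryᵒᵖ} (α : k ⟶ k') (n : SimplexCategory) :
    Hammock.transform (𝟙 n) (levelFunctor α) (W.level_le α) rfl rfl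
      (Hammock.ofHom n (degenerate φ k)) = Hammock.ofHom n (degenerate φ k') := by
  refine (Hammock.transform_ofHom _ _ _ _ _ _).trans (congrArg _ ?_)
  exact (Category.id_comp _).trans ((Category.comp_id _).trans (degenerate_map φ α))

/-- The map of bisimplicial sets `φ_* : L(a, b) ⟶ L(a, c)`, composition with (the image in the
localization of) `φ`. -/
noncomputable def postcomp (W : SimplicialSubcategory.{u, v} C) (a : C) {b c : C}
    (φ : (EnrichedCategory.Hom (V := SSet.{v}) b c).obj (op (SimplexCategory.mk 0))) :
    W.localizedHom a b ⟶ W.localizedHom a c where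
  app k :=
    { app := fun l ↦ ↾fun x : Hammock (W.level k) l.unop a b ↦
        x.comp (Hammock.ofHom l.unop (degenerate φ k))
      naturality := fun l l' θ ↦ by
        ext x
        refine Eq.symm ((Hammock.transform_comp θ.unop (𝟭 _) _ rfl rfl rfl x _).trans ?_)
        refine congrArg _ ((Hammock.transform_ofHom _ _ _ _ _ _).trans (congrArg _ ?_))
        exact (Category.id_comp _).trans (Category.comp_id _) }
  naturality k k' α := by
    ext l x
    refine Eq.symm ((Hammock.transform_comp (𝟙 _) (levelFunctor α) (W.level_le α)
      rfl rfl rfl x _).trans ?_)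
    exact congrArg _ (transform_ofHom_degenerate W φ α _)

/-- The map of bisimplicial sets `φ^* : L(c, a) ⟶ L(b, a)`, composition with (the image in the
localization of) `φ`. -/
noncomputable def precomp (W : SimplicialSubcategory.{u, v} C) (a : C) {b c : C}
    (φ : (EnrichedCategory.Hom (V := SSet.{v}) b c).obj (op (SimplexCategory.mk 0))) :
    W.localizedHom c a ⟶ W.localizedHom b a where
  app k :=
    { app := fun l ↦ ↾fun x : Hammock (W.level k) l.unop c a ↦
        (Hammock.ofHom l.unop (degenerate φ k)).comp x
      naturality := fun l l' θ ↦ by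
        ext x
        refine Eq.symm ((Hammock.transform_comp θ.unop (𝟭 _) _ rfl rfl rfl _ x).trans ?_)
        refine congrArg (fun y ↦ Hammock.comp y _)
          ((Hammock.transform_ofHom _ _ _ _ _ _).trans (congrArg _ ?_))
        exact (Category.id_comp _).trans (Category.comp_id _) }
  naturality k k' α := by
    ext l x
    refine Eq.symm ((Hammock.transform_comp (𝟙 _) (levelFunctor α) (W.level_le α)
      rfl rfl rfl _ x).trans ?_)
    exact congrArg (fun y ↦ Hammock.comp y _) (transform_ofHom_degenerate W φ α _)

end SimplicialSubcategory

end Enriched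

end HammockLocalization

/-! In the localization φ has a formal inverse, the same arrow read as pointing to the left, and it
is an inverse up to an edge of the diagonal mapping space. An edge of the diagonal is a hammock of
height one in `C_1`. The unit edge is the hammock with rows `b = b = b` and `b → c ← b` (both arrows
φ), whose middle vertical arrow is φ itself; this is allowed because φ is in `W`. Row 0 reduces to
the empty hammock, and row 1 is φ followed by its formal inverse. The counit edge, with rows `c ← b
→ c` and `c = c = c`, treats the other composite in the same way (`unitEdge_zero`, `unitEdge_one`,
`counitEdge_zero`, `counitEdge_one`).

Concatenation of hammocks commutes with all simplicial operators, so it gives an associative and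
unital pairing `diagComp` of the diagonals. The diagonals of `φ_*` and `φ^*` are multiplications by
the vertex φ (`diag_map_postcomp`, `diag_map_precomp`), and an edge of one factor of a pairing gives
a homotopy between the multiplications by its endpoints (`mulEdge`). Hence multiplication by the
formal inverse is a homotopy inverse of both maps. A simplicial homotopy equivalence induces
bijections on `[-, Z]` for every `Z`, in particular for Kan complexes. -/

namespace HammockLocalization

open Simplicial CartesianMonoidalCategory

/-! ### Homotopy equivalences -/

namespace HomotopyClass

/-- The map `[X, Y] → [X, Z]` of postcomposition with `g : Y ⟶ Z`. -/
def postcomp (X : SSet.{u}) {Y Z : SSet.{u}} (g : Y ⟶ Z) :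
    HomotopyClass X Y → HomotopyClass X Z :=
  Quot.map (fun f ↦ f ≫ g) fun f f' ⟨H⟩ ↦ ⟨SSet.RelativeMorphism.Homotopy.postcomp H
    (C := ⊥) (ψ := SSet.Subcomplex.isInitialBot.to _) { map := g }
    (SSet.Subcomplex.isInitialBot.hom_ext _ _)⟩

/-- Postcomposing the equality in `[X, X]` with a representative of `z` gives the claim in `[X, Z]`.
As the hypothesis is an equality of classes, the direction of the homotopies does not matter. -/
lemma precomp_precomp_of_eq {X Y Z : SSet.{u}} {f : X ⟶ Y} {g : Y ⟶ X}
    (h : (Quot.mk _ (f ≫ g) : HomotopyClass X X) = Quot.mk _ (𝟙 X)) (z : HomotopyClass X Z) :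
    precomp f Z (precomp g Z z) = z := by
  obtain ⟨k, rfl⟩ := Quot.mk_surjective z
  have := congrArg (postcomp X k) h
  simpa [postcomp, precomp, Quot.map] using this

end HomotopyClass

/-- A map that is invertible up to simplicial homotopy is a weak homotopy equivalence. -/
lemma IsWeakHomotopyEquivalence.of_homotopyInverse {X Y : SSet.{u}} {f : X ⟶ Y} (g : Y ⟶ X)
    (hfg : (Quot.mk _ (f ≫ g) : HomotopyClass X X) = Quot.mk _ (𝟙 X))
    (hgf : (Quot.mk _ (g ≫ f) : HomotopyClass Y Y) = Quot.mk _ (𝟙 Y)) :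
    IsWeakHomotopyEquivalence f := fun _ _ ↦
  Function.bijective_iff_has_inverse.2 ⟨HomotopyClass.precomp g _,
    HomotopyClass.precomp_precomp_of_eq hgf, HomotopyClass.precomp_precomp_of_eq hfg⟩

/-- Multiplication by a vertex `y`, for a pairing of simplicial sets `μ`. -/
noncomputable def mulVertex {X Y Z : SSet.{u}} (μ : X ⊗ Y ⟶ Z) (y : Y _⦋0⦌) : X ⟶ Z :=
  lift (𝟙 X) (SSet.const y) ≫ μ

lemma yonedaEquiv_symm_app_vertex {Y : SSet.{u}} (e : Y _⦋1⦌) (i : Fin 2) :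
    (SSet.yonedaEquiv.symm e).app _ (SSet.stdSimplex.obj₀Equiv.{u}.symm i) =
      Y.map (SimplexCategory.const ⦋0⦌ ⦋1⦌ i).op e :=
  SSet.yonedaEquiv_symm_app_objEquiv_symm e (SimplexCategory.const ⦋0⦌ ⦋1⦌ i)

/-- An edge `e` of `Y` gives a homotopy between the multiplications by its endpoints. -/
noncomputable def mulEdge {X Y Z : SSet.{u}} (μ : X ⊗ Y ⟶ Z) (e : Y _⦋1⦌) :
    SSet.Homotopy (mulVertex μ (Y.map (SimplexCategory.const ⦋0⦌ ⦋1⦌ 0).op e))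
      (mulVertex μ (Y.map (SimplexCategory.const ⦋0⦌ ⦋1⦌ 1).op e)) where
  -- By Yoneda the edge is a map `Δ[1] ⟶ Y`, so the interval coordinate of the homotopy runs along
  -- `e`.
  h := (X ◁ SSet.yonedaEquiv.symm e) ≫ μ
  h₀ := by
    rw [SSet.ι₀, lift_whiskerLeft_assoc, SSet.const_comp, yonedaEquiv_symm_app_vertex]
    rfl
  h₁ := by
    rw [SSet.ι₁, lift_whiskerLeft_assoc, SSet.const_comp, yonedaEquiv_symm_app_vertex]
    rfl
  -- The homotopy is relative to the empty subcomplex, so this condition is vacuous.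
  rel := by
    ext n ⟨⟨x, hx⟩, t⟩
    exact hx.elim

lemma mk_mulVertex_eq {X Y Z : SSet.{u}} (μ : X ⊗ Y ⟶ Z) (e : Y _⦋1⦌) {y y' : Y _⦋0⦌}
    (h : Y.map (SimplexCategory.const ⦋0⦌ ⦋1⦌ 0).op e = y)
    (h' : Y.map (SimplexCategory.const ⦋0⦌ ⦋1⦌ 1).op e = y') :
    (Quot.mk _ (mulVertex μ y) : HomotopyClass X Z) = Quot.mk _ (mulVertex μ y') := by
  subst h h'
  exact Quot.sound ⟨mulEdge μ e⟩

/-! ### Composition of hammocks -/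

namespace Zigzag

variable {D : Type u} [Category.{v} D] {V : MorphismProperty D}

lemma append_nil {x y : D} (w : Zigzag V x y) : append w (nil y) = w := by
  induction w with
  | nil => rfl
  | cons s w ih => rw [append, ih]

lemma append_assoc {x y z t : D} (w : Zigzag V x y) (w' : Zigzag V y z) (w'' : Zigzag V z t) :
    append (append w w') w'' = append w (append w' w'') := by
  induction w with
  | nil => rfl
  | cons s w ih => simp only [append, ih]

end Zigzag

/-- The step given by a morphism of `W`, pointing to the left in every row. -/
def Chain.invStep {C : Type u} [Category.{v} C] {W : MorphismProperty C} [W.IsMultiplicative]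
    (n : SimplexCategory) {a b : C} (f : a ⟶ b) (hf : W f) :
    Step (levelwise W n) .left (const W n b) (const W n a) :=
  ⟨constMap W n f, fun _ ↦ hf⟩

namespace Hammock

variable {C : Type u} [Category.{v} C] {W : MorphismProperty C} [W.IsMultiplicative]
  {n : SimplexCategory} {C' : Type u'} [Category.{v'} C'] {W' : MorphismProperty C'}
  [W'.IsMultiplicative]

/-- Reducing either factor beforehand does not change the reduction of a concatenation. Composites
can therefore be computed on unreduced representatives, where associativity is that of concatenating
lists. -/
lemma mk_comp_mk {a b c : C}
    (w : Zigzag (Chain.levelwise W n) (Chain.const W n a) (Chain.const W n b))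
    (w' : Zigzag (Chain.levelwise W n) (Chain.const W n b) (Chain.const W n c)) :
    (mk w).comp (mk w') = mk (w.append w') :=
  Subtype.ext ((Zigzag.reduce_append_reduce_left _ _).trans
    (Zigzag.reduce_append_reduce_right _ _))

lemma mk_val {a b : C} (x : Hammock W n a b) : mk x.1 = x :=
  Subtype.ext (Zigzag.reduce_of_reduced _ x.2)

lemma comp_assoc {a b c d : C} (x : Hammock W n a b) (y : Hammock W n b c)
    (z : Hammock W n c d) : (x.comp y).comp z = x.comp (y.comp z) := by
  rw [← mk_val x, ← mk_val y, ← mk_val z]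
  simp only [mk_comp_mk, Zigzag.append_assoc]

/-- The identity hammock, with no columns of horizontal arrows. -/
def nil (W : MorphismProperty C) [W.IsMultiplicative] (n : SimplexCategory) (a : C) :
    Hammock W n a a :=
  ⟨.nil _, trivial⟩

lemma comp_nil {a b : C} (x : Hammock W n a b) : x.comp (nil W n b) = x :=
  (congrArg mk (Zigzag.append_nil x.1)).trans (mk_val x)

lemma nil_comp {a b : C} (x : Hammock W n a b) : (nil W n a).comp x = x :=
  mk_val x

lemma transform_mk {m : SimplexCategory} (θ : m ⟶ n) (G : C ⥤ C')
    (hG : W ≤ W'.inverseImage G) {a b : C} {a' b' : C'} (ha : G.obj a = a') (hb : G.obj b = b')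
    (w : Zigzag (Chain.levelwise W n) (Chain.const W n a) (Chain.const W n b)) :
    transform θ G hG ha hb (mk w) =
      mk (w.mapTo (Chain.transform θ G hG) (Chain.transform_levelwise θ G hG)
        (Chain.transform_const θ G hG ha) (Chain.transform_const θ G hG hb)) :=
  Subtype.ext (Zigzag.reduce_mapTo_reduce _ _ _ _ _)

/-- The hammock given by the formal inverse of a morphism `f : a ⟶ b` of `W`. -/
noncomputable def ofInv (n : SimplexCategory) {a b : C} (f : a ⟶ b) (hf : W f) :
    Hammock W n b a :=
  mk (.cons (Chain.invStep n f hf) (.nil _))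

lemma ofHom_comp_ofInv {a b : C} (f : a ⟶ b) (hf : W f) :
    (ofHom n f).comp (ofInv n f hf) =
      mk (.cons (Step.ofHom (Chain.constMap W n f)) (.cons (Chain.invStep n f hf) (.nil _))) :=
  mk_comp_mk _ _

lemma ofInv_comp_ofHom {a b : C} (f : a ⟶ b) (hf : W f) :
    (ofInv n f hf).comp (ofHom n f) =
      mk (.cons (Chain.invStep n f hf) (.cons (Step.ofHom (Chain.constMap W n f)) (.nil _))) :=
  mk_comp_mk _ _

end Hammock

/-! ### Images of zigzags, one arrow at a time -/

namespace Zigzag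

variable {D : Type u} [Category.{v} D] {V : MorphismProperty D}
  {D' : Type u'} [Category.{v'} D'] {V' : MorphismProperty D'}

lemma mapTo_nil (F : D ⥤ D') (hF : V ≤ V'.inverseImage F) {x : D} {x' : D'}
    (hx : F.obj x = x') : mapTo F hF hx hx (nil x) = nil x' := by
  subst hx
  rfl

/-- The images of the objects may equal the prescribed ones only propositionally; `hf` collects all
the transport in one equation between arrows, including that at the intermediate object. -/
lemma mapTo_cons_right (F : D ⥤ D') (hF : V ≤ V'.inverseImage F) {x y z : D} {x' y' z' : D'}
    (hx : F.obj x = x') (hy : F.obj y = y') (hz : F.obj z = z') (f : x ⟶ y) (f' : x' ⟶ y')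
    (hf : eqToHom hx.symm ≫ F.map f ≫ eqToHom hy = f') (w : Zigzag V y z) :
    mapTo F hF hx hz (cons (Step.ofHom f) w) =
      cons (Step.ofHom f') (mapTo F hF hy hz w) := by
  subst hx hy hz hf
  rw [eqToHom_refl, eqToHom_refl, Category.comp_id, Category.id_comp]
  rfl

lemma mapTo_cons_left (F : D ⥤ D') (hF : V ≤ V'.inverseImage F) {x y z : D} {x' y' z' : D'}
    (hx : F.obj x = x') (hy : F.obj y = y') (hz : F.obj z = z') (f : y ⟶ x) (h : V f)
    (f' : y' ⟶ x') (h' : V' f') (hf : eqToHom hy.symm ≫ F.map f ≫ eqToHom hx = f')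
    (w : Zigzag V y z) :
    mapTo F hF hx hz (cons (d := .left) ⟨f, h⟩ w) =
      cons (d := .left) ⟨f', h'⟩ (mapTo F hF hy hz w) := by
  subst hx hy hz
  obtain rfl : F.map f = f' := by simpa using hf
  rfl

end Zigzag

/-! ### Columns of height zero and one -/

namespace Chain

variable {C : Type u} [Category.{v} C] {W : MorphismProperty C}

lemma comp_app {n : SimplexCategory} {X Y Z : Chain W n} (f : X ⟶ Y) (g : Y ⟶ Z)
    (i : Fin (n.len + 1)) : NatTrans.app (f ≫ g) i = NatTrans.app f i ≫ NatTrans.app g i := rfl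

lemma hom_ext_zero {X Y : Chain W ⦋0⦌} {f g : X ⟶ Y}
    (h : NatTrans.app f 0 = NatTrans.app g 0) : f = g := by
  apply NatTrans.ext
  funext i
  rw [Subsingleton.elim (α := Fin 1) i 0]
  exact h

variable [W.IsMultiplicative]

/-- The chain of length one given by a morphism of `W`. -/
def arrow {a b : C} (f : a ⟶ b) (hf : W f) : Chain W ⦋1⦌ where
  functor := ComposableArrows.mk₁ f
  mem {i j} h := by
    match i, j, leOfHom h with
    | 0, 0, _ => exact W.id_mem a
    | 0, 1, _ => exact hf
    | 1, 1, _ => exact W.id_mem b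

/-- The morphism from the column of identities of `a` to the chain `f : a ⟶ b`. -/
def toArrow {a b : C} (f : a ⟶ b) (hf : W f) : const W ⦋1⦌ a ⟶ arrow f hf :=
  ComposableArrows.homMk₁ (F := (Functor.const (Fin 2)).obj a) (G := ComposableArrows.mk₁ f)
    (𝟙 a) f rfl

/-- The morphism from the chain `f : a ⟶ b` to the column of identities of `b`. -/
def fromArrow {a b : C} (f : a ⟶ b) (hf : W f) : arrow f hf ⟶ const W ⦋1⦌ b :=
  ComposableArrows.homMk₁ (F := ComposableArrows.mk₁ f) (G := (Functor.const (Fin 2)).obj b)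
    f (𝟙 b) rfl

lemma toArrow_levelwise {a b : C} (f : a ⟶ b) (hf : W f) : levelwise W ⦋1⦌ (toArrow f hf) := by
  intro i
  match i with
  | 0 => exact W.id_mem a
  | 1 => exact hf

lemma fromArrow_levelwise {a b : C} (f : a ⟶ b) (hf : W f) :
    levelwise W ⦋1⦌ (fromArrow f hf) := by
  intro i
  match i with
  | 0 => exact hf
  | 1 => exact W.id_mem b

/-- A chain with a single row carries only identity arrows. This makes a single row of the middle
column of a unit or counit edge a constant column. -/
lemma eq_const (X : Chain W ⦋0⦌) {a : C} (h : X.functor.obj 0 = a) : X = const W ⦋0⦌ a := by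
  subst h
  obtain ⟨F, hF⟩ := X
  have : F = (Functor.const _).obj (F.obj 0) := by
    refine CategoryTheory.Functor.ext (fun i ↦ ?_) (fun i j h ↦ ?_)
    · rw [Subsingleton.elim (α := Fin 1) i 0]; rfl
    · obtain rfl : i = 0 := Subsingleton.elim (α := Fin 1) _ _
      obtain rfl : j = 0 := Subsingleton.elim (α := Fin 1) _ _
      obtain rfl : h = 𝟙 _ := Subsingleton.elim _ _
      rw [F.map_id]
      simp
  simp only [const]
  congr

end Chain

/-! ### Unit and counit hammocks and their rows -/

namespace Hammock

variable {C : Type u} [Category.{v} C] {W : MorphismProperty C} [W.IsMultiplicative]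
  {C' : Type u'} [Category.{v'} C'] {W' : MorphismProperty C'} [W'.IsMultiplicative]

/-- The hammock of height one from the identity to the composite of `f` and its formal
inverse. -/
noncomputable def unitEdge {a b : C} (f : a ⟶ b) (hf : W f) : Hammock W ⦋1⦌ a a :=
  mk (.cons (Step.ofHom (Chain.toArrow f hf))
    (.cons (d := .left) ⟨Chain.toArrow f hf, Chain.toArrow_levelwise f hf⟩ (.nil _)))

/-- The hammock of height one from the composite of the formal inverse of `f` and `f` to the
identity. -/
noncomputable def counitEdge {a b : C} (f : a ⟶ b) (hf : W f) : Hammock W ⦋1⦌ b b :=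
  mk (.cons (d := .left) ⟨Chain.fromArrow f hf, Chain.fromArrow_levelwise f hf⟩
    (.cons (Step.ofHom (Chain.fromArrow f hf)) (.nil _)))

/-- Both columns consist of identities, so reduction omits them one after the other. -/
lemma ofHom_comp_ofInv_of_eq_id {n : SimplexCategory} {a : C} {f : a ⟶ a} (hf : W f)
    (h : f = 𝟙 a) : (ofHom n f).comp (ofInv n f hf) = nil W n a := by
  subst h
  rw [ofHom_comp_ofInv]
  exact Subtype.ext ((congrArg (Zigzag.push _)
      (Zigzag.push_id (d := .left) (V := Chain.levelwise W n)
      (.nil (Chain.const W n a)) trivial)).trans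
    (Zigzag.push_id (d := .right) (V := Chain.levelwise W n)
      (.nil (Chain.const W n a)) trivial))

lemma ofInv_comp_ofHom_of_eq_id {n : SimplexCategory} {a : C} {f : a ⟶ a} (hf : W f)
    (h : f = 𝟙 a) : (ofInv n f hf).comp (ofHom n f) = nil W n a := by
  subst h
  rw [ofInv_comp_ofHom]
  exact Subtype.ext ((congrArg (Zigzag.push _)
      (Zigzag.push_id (d := .right) (V := Chain.levelwise W n)
      (.nil (Chain.const W n a)) trivial)).trans
    (Zigzag.push_id (d := .left) (V := Chain.levelwise W n)
      (.nil (Chain.const W n a)) trivial))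

/-- Restriction along `θ` keeps only the row `θ 0`, where both arrows are the component of `p`.
Leaving `θ` and `p` arbitrary lets one computation serve both ends of the unit edge. -/
lemma transform_zero_cospan {n : SimplexCategory} (θ : ⦋0⦌ ⟶ n) (G : C ⥤ C')
    (hG : W ≤ W'.inverseImage G) {a : C} {X : Chain W n} (p : Chain.const W n a ⟶ X)
    (hp : Chain.levelwise W n p) :
    transform θ G hG rfl rfl (mk (.cons (Step.ofHom p) (.cons (d := .left) ⟨p, hp⟩ (.nil _)))) =
      (ofHom ⦋0⦌ (G.map (NatTrans.app p (θ.toOrderHom 0)))).comp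
        (ofInv (W := W') ⦋0⦌ (G.map (NatTrans.app p (θ.toOrderHom 0))) (hG _ (hp _))) := by
  have hX : (Chain.transform θ G hG).obj X =
      Chain.const W' ⦋0⦌ (G.obj (X.functor.obj (θ.toOrderHom 0))) := Chain.eq_const _ rfl
  -- In the only row the transports join definitionally equal objects, so they act as identities.
  have key : eqToHom (Chain.transform_const θ G hG rfl).symm ≫
      (Chain.transform θ G hG).map p ≫ eqToHom hX =
        Chain.constMap W' ⦋0⦌ (G.map (NatTrans.app p (θ.toOrderHom 0))) := by
    apply Chain.hom_ext_zero
    rw [Chain.comp_app, Chain.comp_app, Chain.eqToHom_app, Chain.eqToHom_app]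
    exact (Category.id_comp _).trans (Category.comp_id _)
  refine (transform_mk _ _ _ _ _ _).trans (Eq.trans (congrArg mk ?_) (ofHom_comp_ofInv _ _).symm)
  refine (Zigzag.mapTo_cons_right _ _ _ hX _ _ _ key _).trans (congrArg (Zigzag.cons _) ?_)
  refine (Zigzag.mapTo_cons_left _ _ _ (Chain.transform_const θ G hG rfl) _ p _ _
    (fun _ ↦ hG _ (hp _)) key _).trans (congrArg (Zigzag.cons _) ?_)
  exact Zigzag.mapTo_nil _ _ _

/-- The mirror image of `transform_zero_cospan`, for the two ends of the counit edge. -/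
lemma transform_zero_span {n : SimplexCategory} (θ : ⦋0⦌ ⟶ n) (G : C ⥤ C')
    (hG : W ≤ W'.inverseImage G) {a : C} {X : Chain W n} (p : X ⟶ Chain.const W n a)
    (hp : Chain.levelwise W n p) :
    transform θ G hG rfl rfl (mk (.cons (d := .left) ⟨p, hp⟩ (.cons (Step.ofHom p) (.nil _)))) =
      (ofInv (W := W') ⦋0⦌ (G.map (NatTrans.app p (θ.toOrderHom 0))) (hG _ (hp _))).comp
        (ofHom ⦋0⦌ (G.map (NatTrans.app p (θ.toOrderHom 0)))) := by
  have hX : (Chain.transform θ G hG).obj X =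
      Chain.const W' ⦋0⦌ (G.obj (X.functor.obj (θ.toOrderHom 0))) := Chain.eq_const _ rfl
  have key : eqToHom hX.symm ≫ (Chain.transform θ G hG).map p ≫
      eqToHom (Chain.transform_const θ G hG rfl) =
        Chain.constMap W' ⦋0⦌ (G.map (NatTrans.app p (θ.toOrderHom 0))) := by
    apply Chain.hom_ext_zero
    rw [Chain.comp_app, Chain.comp_app, Chain.eqToHom_app, Chain.eqToHom_app]
    exact (Category.id_comp _).trans (Category.comp_id _)
  refine (transform_mk _ _ _ _ _ _).trans (Eq.trans (congrArg mk ?_) (ofInv_comp_ofHom _ _).symm)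
  refine (Zigzag.mapTo_cons_left _ _ _ hX _ p _ _ (fun _ ↦ hG _ (hp _)) key _).trans
    (congrArg (Zigzag.cons _) ?_)
  refine (Zigzag.mapTo_cons_right _ _ _ (Chain.transform_const θ G hG rfl) _ _ _ key _).trans
    (congrArg (Zigzag.cons _) ?_)
  exact Zigzag.mapTo_nil _ _ _

end Hammock

/-! ### The diagonal mapping spaces and their composition -/

namespace SimplicialSubcategory

variable {C : Type u} [EnrichedCategory SSet.{v} C] (W : SimplicialSubcategory.{u, v} C)

/-- The diagonal of the bisimplicial set of morphisms in the hammock localization. -/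
noncomputable abbrev diagHom (a b : C) : SSet.{max u v} := diag.obj (W.localizedHom a b)

/-- An operator of the diagonal acts on the simplicial level of `C` and then on the rows;
functoriality of `Hammock.transform` merges the two actions. -/
lemma diagHom_map {a b : C} {m n : SimplexCategoryᵒᵖ} (θ : m ⟶ n)
    (x : Hammock (W.level m) m.unop a b) :
    (W.diagHom a b).map θ x =
      Hammock.transform θ.unop (levelFunctor θ) (W.level_le θ) rfl rfl x :=
  Hammock.transform_transform _ _ _ rfl rfl _ _ _ rfl rfl _ rfl (W.level_le θ) rfl rfl x

/-- The composition of the hammock localization, on diagonals. -/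
noncomputable def diagComp (a b c : C) : W.diagHom a b ⊗ W.diagHom b c ⟶ W.diagHom a c where
  app n := ↾fun p ↦ Hammock.comp (W := W.level n) p.1 p.2
  naturality m n θ := by
    ext ⟨x, y⟩
    refine Eq.trans ?_ (W.diagHom_map θ _).symm
    refine Eq.trans ?_ (Hammock.transform_comp θ.unop (levelFunctor θ) (W.level_le θ)
      rfl rfl rfl x y).symm
    exact congrArg₂ Hammock.comp (W.diagHom_map θ x) (W.diagHom_map θ y)

/-- The vertex of the localization given by a morphism of `C`. -/
noncomputable def vertex {b c : C}
    (φ : (EnrichedCategory.Hom (V := SSet.{v}) b c).obj (op (SimplexCategory.mk 0))) :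
    (W.diagHom b c).obj (op ⦋0⦌) :=
  Hammock.ofHom (W := W.level (op ⦋0⦌)) ⦋0⦌ (degenerate φ (op ⦋0⦌))

lemma degenerate_mem {b c : C}
    {φ : (EnrichedCategory.Hom (V := SSet.{v}) b c).obj (op (SimplexCategory.mk 0))}
    (hφ : φ ∈ (W.hom b c).obj (op (SimplexCategory.mk 0))) (k : SimplexCategoryᵒᵖ) :
    W.level k (degenerate φ k) :=
  (W.hom b c).map _ hφ

/-- The vertex of the localization given by the formal inverse of a morphism of `W`. -/
noncomputable def invVertex {b c : C}
    {φ : (EnrichedCategory.Hom (V := SSet.{v}) b c).obj (op (SimplexCategory.mk 0))}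
    (hφ : φ ∈ (W.hom b c).obj (op (SimplexCategory.mk 0))) :
    (W.diagHom c b).obj (op ⦋0⦌) :=
  Hammock.ofInv (W := W.level (op ⦋0⦌)) ⦋0⦌ (degenerate φ (op ⦋0⦌)) (W.degenerate_mem hφ _)

/-- The identity vertex of the localization. -/
noncomputable def idVertex (b : C) : (W.diagHom b b).obj (op ⦋0⦌) :=
  Hammock.nil (W.level (op ⦋0⦌)) ⦋0⦌ b

/-- The degeneracies of the vertex φ are exactly the hammocks by which `postcomp` and `precomp`
multiply in degree `n`. -/
lemma diagHom_map_vertex {b c : C}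
    (φ : (EnrichedCategory.Hom (V := SSet.{v}) b c).obj (op (SimplexCategory.mk 0)))
    {n : SimplexCategoryᵒᵖ} (θ : op ⦋0⦌ ⟶ n) :
    (W.diagHom b c).map θ (W.vertex φ) =
      Hammock.ofHom (W := W.level n) n.unop (degenerate φ n) := by
  refine (W.diagHom_map θ _).trans ((Hammock.transform_ofHom _ _ _ _ _ _).trans (congrArg _ ?_))
  exact (Category.id_comp _).trans ((Category.comp_id _).trans (degenerate_map φ θ))

lemma diagHom_map_idVertex {b : C} {n : SimplexCategoryᵒᵖ} (θ : op ⦋0⦌ ⟶ n) :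
    (W.diagHom b b).map θ (W.idVertex b) = Hammock.nil (W.level n) n.unop b := by
  refine (W.diagHom_map θ _).trans ?_
  refine (congrArg _ (Hammock.mk_val _).symm).trans ((Hammock.transform_mk _ _ _ _ _ _).trans ?_)
  exact (congrArg Hammock.mk (Zigzag.mapTo_nil _ _ _)).trans
    (Hammock.mk_val (Hammock.nil (W.level n) n.unop b))

/-- The edge of the localization from the identity to the composite of `φ` and its formal
inverse. -/
noncomputable def unitEdge {b c : C}
    {φ : (EnrichedCategory.Hom (V := SSet.{v}) b c).obj (op (SimplexCategory.mk 0))}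
    (hφ : φ ∈ (W.hom b c).obj (op (SimplexCategory.mk 0))) :
    (W.diagHom b b).obj (op ⦋1⦌) :=
  Hammock.unitEdge (W := W.level (op ⦋1⦌)) (degenerate φ (op ⦋1⦌)) (W.degenerate_mem hφ _)

/-- The edge of the localization from the composite of the formal inverse of `φ` and `φ` to
the identity. -/
noncomputable def counitEdge {b c : C}
    {φ : (EnrichedCategory.Hom (V := SSet.{v}) b c).obj (op (SimplexCategory.mk 0))}
    (hφ : φ ∈ (W.hom b c).obj (op (SimplexCategory.mk 0))) :
    (W.diagHom c c).obj (op ⦋1⦌) :=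
  Hammock.counitEdge (W := W.level (op ⦋1⦌)) (degenerate φ (op ⦋1⦌)) (W.degenerate_mem hφ _)

/-! ### Endpoints of the unit and counit edges -/

section

variable {b c : C}
  {φ : (EnrichedCategory.Hom (V := SSet.{v}) b c).obj (op (SimplexCategory.mk 0))}
  (hφ : φ ∈ (W.hom b c).obj (op (SimplexCategory.mk 0)))

/-- `Chain.toArrow` is the identity in row 0, and the level functor preserves identities. -/
lemma unitEdge_zero :
    (W.diagHom b b).map (SimplexCategory.const ⦋0⦌ ⦋1⦌ 0).op (W.unitEdge hφ) = W.idVertex b := by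
  refine (W.diagHom_map _ _).trans ((Hammock.transform_zero_cospan _ _ _ _ _).trans ?_)
  exact Hammock.ofHom_comp_ofInv_of_eq_id _ (CategoryTheory.Functor.map_id _ _)

lemma unitEdge_one :
    (W.diagHom b b).map (SimplexCategory.const ⦋0⦌ ⦋1⦌ 1).op (W.unitEdge hφ) =
      (W.diagComp b c b).app _ ⟨W.vertex φ, W.invVertex hφ⟩ := by
  refine (W.diagHom_map _ _).trans ((Hammock.transform_zero_cospan _ _ _ _ _).trans ?_)
  have h := degenerate_map φ (SimplexCategory.const ⦋0⦌ ⦋1⦌ 1).op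
  -- Row 1 of `Chain.toArrow` is by definition the degenerate φ of level 1, and `h` restricts it to
  -- level 0.
  change (Hammock.ofHom ⦋0⦌ ((levelFunctor _).map (degenerate φ _))).comp
    (Hammock.ofInv (W := W.level (op ⦋0⦌)) ⦋0⦌ ((levelFunctor _).map (degenerate φ _)) _) = _
  simp only [h]
  rfl

/-- `Chain.fromArrow` has φ in row 0 and the identity in row 1, so this edge ends at the identity,
whereas the unit edge starts there. -/
lemma counitEdge_zero :
    (W.diagHom c c).map (SimplexCategory.const ⦋0⦌ ⦋1⦌ 0).op (W.counitEdge hφ) =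
      (W.diagComp c b c).app _ ⟨W.invVertex hφ, W.vertex φ⟩ := by
  refine (W.diagHom_map _ _).trans ((Hammock.transform_zero_span _ _ _ _ _).trans ?_)
  have h := degenerate_map φ (SimplexCategory.const ⦋0⦌ ⦋1⦌ 0).op
  change (Hammock.ofInv (W := W.level (op ⦋0⦌)) ⦋0⦌ ((levelFunctor _).map (degenerate φ _)) _).comp
    (Hammock.ofHom ⦋0⦌ ((levelFunctor _).map (degenerate φ _))) = _
  simp only [h]
  rfl

lemma counitEdge_one :
    (W.diagHom c c).map (SimplexCategory.const ⦋0⦌ ⦋1⦌ 1).op (W.counitEdge hφ) =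
      W.idVertex c := by
  refine (W.diagHom_map _ _).trans ((Hammock.transform_zero_span _ _ _ _ _).trans ?_)
  exact Hammock.ofInv_comp_ofHom_of_eq_id _ (CategoryTheory.Functor.map_id _ _)

end

/-! ### Composition maps as multiplication by vertices -/

lemma diag_map_postcomp (a : C) {b c : C}
    (φ : (EnrichedCategory.Hom (V := SSet.{v}) b c).obj (op (SimplexCategory.mk 0))) :
    diag.map (W.postcomp a φ) = mulVertex (W.diagComp a b c) (W.vertex φ) := by
  ext n x
  exact congrArg (Hammock.comp x) (W.diagHom_map_vertex φ _).symm

/-- The braiding puts the fixed vertex in the first factor of the composition, so the same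
`mulVertex` serves on this side. -/
lemma diag_map_precomp (a : C) {b c : C}
    (φ : (EnrichedCategory.Hom (V := SSet.{v}) b c).obj (op (SimplexCategory.mk 0))) :
    diag.map (W.precomp a φ) = mulVertex ((β_ _ _).hom ≫ W.diagComp b c a) (W.vertex φ) := by
  ext n x
  exact congrArg (fun y ↦ Hammock.comp y x) (W.diagHom_map_vertex φ _).symm

lemma mulVertex_diagComp_comp (a : C) {b c d : C} (x : (W.diagHom b c).obj (op ⦋0⦌))
    (y : (W.diagHom c d).obj (op ⦋0⦌)) :
    mulVertex (W.diagComp a b c) x ≫ mulVertex (W.diagComp a c d) y =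
      mulVertex (W.diagComp a b d) ((W.diagComp b c d).app _ ⟨x, y⟩) := by
  ext n z
  -- `θ` degenerates both vertices to degree `n`; naturality of the pairing says that the product of
  -- the degenerate simplices is the degeneracy of the product.
  let θ := (SimplexCategory.const n.unop ⦋0⦌ 0).op
  have h := NatTrans.naturality_apply (W.diagComp b c d) θ (⟨x, y⟩ : (_ ⊗ _ : SSet).obj _)
  exact (Hammock.comp_assoc (W := W.level n) z ((W.diagHom b c).map θ x)
    ((W.diagHom c d).map θ y)).trans (congrArg (Hammock.comp (W := W.level n) z) h)

/-- Multiplication on the left is contravariant: `y` acts before `x`, because it stands next to `z`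
in `x · (y · z)`. -/
lemma mulVertex_braiding_diagComp_comp (a : C) {b c d : C} (x : (W.diagHom b c).obj (op ⦋0⦌))
    (y : (W.diagHom c d).obj (op ⦋0⦌)) :
    mulVertex ((β_ _ _).hom ≫ W.diagComp c d a) y ≫
      mulVertex ((β_ _ _).hom ≫ W.diagComp b c a) x =
      mulVertex ((β_ _ _).hom ≫ W.diagComp b d a) ((W.diagComp b c d).app _ ⟨x, y⟩) := by
  ext n z
  let θ := (SimplexCategory.const n.unop ⦋0⦌ 0).op
  have h := NatTrans.naturality_apply (W.diagComp b c d) θ (⟨x, y⟩ : (_ ⊗ _ : SSet).obj _)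
  exact (Hammock.comp_assoc (W := W.level n) ((W.diagHom b c).map θ x)
    ((W.diagHom c d).map θ y) z).symm.trans
    (congrArg (fun t ↦ Hammock.comp (W := W.level n) t z) h)

lemma mulVertex_diagComp_id (a b : C) :
    mulVertex (W.diagComp a b b) (W.idVertex b) = 𝟙 _ := by
  ext n z
  exact (congrArg (Hammock.comp z) (W.diagHom_map_idVertex _)).trans (Hammock.comp_nil _)

lemma mulVertex_braiding_diagComp_id (a b : C) :
    mulVertex ((β_ _ _).hom ≫ W.diagComp b b a) (W.idVertex b) = 𝟙 _ := by
  ext n z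
  exact (congrArg (fun t ↦ Hammock.comp t z) (W.diagHom_map_idVertex _)).trans
    (Hammock.nil_comp _)

end SimplicialSubcategory

end HammockLocalization

theorem mainTheorem9 {C : Type u} [EnrichedCategory SSet.{v} C]
    (W : HammockLocalization.SimplicialSubcategory.{u, v} C) {b c : C}
    (φ : (EnrichedCategory.Hom (V := SSet.{v}) b c).obj (op (SimplexCategory.mk 0)))
    (hφ : φ ∈ (W.hom b c).obj (op (SimplexCategory.mk 0))) (a : C) :
    HammockLocalization.IsWeakHomotopyEquivalence
        (HammockLocalization.diag.map (W.postcomp a φ)) ∧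
      HammockLocalization.IsWeakHomotopyEquivalence
        (HammockLocalization.diag.map (W.precomp a φ)) := by
  open HammockLocalization in
  rw [W.diag_map_postcomp, W.diag_map_precomp]
  refine ⟨.of_homotopyInverse (mulVertex (W.diagComp a c b) (W.invVertex hφ)) ?_ ?_,
    .of_homotopyInverse (mulVertex ((β_ _ _).hom ≫ W.diagComp c b a) (W.invVertex hφ)) ?_ ?_⟩
  -- The composite multiplies by φ and then by its formal inverse, the final vertex of the unit
  -- edge. That edge starts at the identity, hence the `symm`.
  · rw [W.mulVertex_diagComp_comp, ← W.mulVertex_diagComp_id]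
    exact (mk_mulVertex_eq _ _ (W.unitEdge_zero hφ) (W.unitEdge_one hφ)).symm
  · rw [W.mulVertex_diagComp_comp, ← W.mulVertex_diagComp_id]
    exact mk_mulVertex_eq _ _ (W.counitEdge_zero hφ) (W.counitEdge_one hφ)
  -- Contravariance exchanges the edges: here φ acts first, but the resulting product is the formal
  -- inverse followed by φ, so the counit edge is needed.
  · rw [W.mulVertex_braiding_diagComp_comp, ← W.mulVertex_braiding_diagComp_id]
    exact mk_mulVertex_eq _ _ (W.counitEdge_zero hφ) (W.counitEdge_one hφ)
  · rw [W.mulVertex_braiding_diagComp_comp, ← W.mulVertex_braiding_diagComp_id]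
    exact (mk_mulVertex_eq _ _ (W.unitEdge_zero hφ) (W.unitEdge_one hφ)).symm
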